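/- Let $E$ be a complex Banach algebra with identity (not necessarily commutative) and $\dim_{\mathbb C} E>1$. Let $\mathcal H_b(E,E)$ be the space of all holomorphic maps $f:E\to E$ of bounded type, that is, maps that are analytic on all of $E$ and bounded on every bounded subset of $E$, endowed with the topology of uniform convergence on the bounded subsets of $E$. A map $f:E\to E$ is called Lorch-analytic if for every $\omega\in E$ there exists $\zeta\in E$ such that $$\lim_{h\to 0}\frac{\|f(\omega+h)-f(\omega)-\zeta\cdot h\|}{\|h\|}=0,$$ and $\mathcal H_L(E,E)$ denotes the set of all Lorch-analytic maps $E\to E$. Then the set $\mathcal G_b(E)=\mathcal H_b(E,E)\setminus\mathcal H_L(E,E)$ is spaceable in $\mathcal H_b(E,E)$: there is a closed infinite-dimensional vector subspace of $\mathcal H_b(E,E)$ contained in $\mathcal G_b(E)\cup\{0\}$. -/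

import Mathlib

open Filter Topology

noncomputable section

/-- `A ⊆ Y` is spaceable: `A ∪ {0}` contains a closed infinite dimensional vector subspace of
the complex topological vector space `Y`. -/
def IsSpaceable {Y : Type*} [AddCommGroup Y] [Module ℂ Y] [TopologicalSpace Y]
    [IsTopologicalAddGroup Y] [ContinuousSMul ℂ Y] (A : Set Y) : Prop :=
  ∃ S : Submodule ℂ Y, IsClosed (S : Set Y) ∧ ¬ FiniteDimensional ℂ S ∧ (S : Set Y) ⊆ A ∪ {0}

/-- `ζ` is a derivative of `f` at `ω` in the sense of Lorch. -/
def HasLorchDerivAt {E : Type*} [NormedRing E] (f : E → E) (ζ ω : E) : Prop :=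
  Tendsto (fun h : E => ‖f (ω + h) - f ω - ζ * h‖ / ‖h‖) (𝓝[≠] 0) (𝓝 0)

/-- `f` is Lorch-analytic in `E`: it has a derivative in the sense of Lorch at every point. -/
def IsLorchAnalytic {E : Type*} [NormedRing E] (f : E → E) : Prop :=
  ∀ ω : E, ∃ ζ : E, HasLorchDerivAt f ζ ω

/-- All maps `E → E`, with the topology of uniform convergence on bounded subsets of `E`. -/
abbrev BddConvFun (E : Type*) [NormedRing E] : Type _ :=
  UniformOnFun E E {s : Set E | Bornology.IsBounded s}

/-- The map underlying an element of `BddConvFun E`. -/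
abbrev BddConvFun.toMap {E : Type*} [NormedRing E] (f : BddConvFun E) : E → E :=
  UniformOnFun.toFun {s : Set E | Bornology.IsBounded s} f

/-- `𝓗_b(E, E)`: the holomorphic maps `E → E` of bounded type, that is, those which are analytic
on the whole of `E` and bounded on every bounded subset of `E`. As a subspace of `BddConvFun E`
it carries the topology of uniform convergence on bounded sets. -/
def Hb (E : Type*) [NormedRing E] [NormedAlgebra ℂ E] : Submodule ℂ (BddConvFun E) where
  carrier := {f | AnalyticOnNhd ℂ f.toMap Set.univ ∧
    ∀ s : Set E, Bornology.IsBounded s → Bornology.IsBounded (f.toMap '' s)}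
  zero_mem' := by
    refine ⟨fun x _ => analyticAt_const (v := (0 : E)), fun s _ => ?_⟩
    refine (Bornology.isBounded_singleton (x := (0 : E))).subset ?_
    rintro _ ⟨x, _, rfl⟩
    rfl
  add_mem' := by
    rintro f g ⟨hf, hf'⟩ ⟨hg, hg'⟩
    refine ⟨hf.add hg, fun s hs => ((hf' s hs).add (hg' s hs)).subset ?_⟩
    rintro _ ⟨x, hx, rfl⟩
    exact Set.add_mem_add ⟨x, hx, rfl⟩ ⟨x, hx, rfl⟩
  smul_mem' := by
    rintro c f ⟨hf, hf'⟩
    refine ⟨fun x hx => (hf x hx).const_smul (c := c), fun s hs => ((hf' s hs).smul₀ c).subset ?_⟩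
    rintro _ ⟨x, hx, rfl⟩
    exact Set.smul_mem_smul_set ⟨x, hx, rfl⟩

instance Hb.instContinuousSMul (E : Type*) [NormedRing E] [NormedAlgebra ℂ E] :
    ContinuousSMul ℂ (Hb E) :=
  UniformOnFun.continuousSMul_induced_of_image_bounded ℂ E E (Hb E)
    (φ := (Hb E).subtype) ⟨rfl⟩
    (fun f s hs => (NormedSpace.isVonNBounded_iff ℂ).2 (f.2.2 s hs))

/-- `𝓖_b(E) = 𝓗_b(E, E) \ 𝓗_L(E, E)`, as a subset of `𝓗_b(E, E)`. -/
def Gb (E : Type*) [NormedRing E] [NormedAlgebra ℂ E] : Set (Hb E) :=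
  {f | ¬ IsLorchAnalytic (f : BddConvFun E).toMap}

end

/-!
A Lorch derivative `ζ` is a Fréchet derivative equal to left multiplication by `ζ`, so it can be
read off in the direction `1`. Hence a Lorch-analytic map that is invariant under translation by
scalars has derivative zero everywhere and is constant. The scalar-invariant maps in `𝓗_b(E, E)`
that vanish at `0` form a closed subspace, in which only `0` is Lorch-analytic. When `dim E > 1` the
Hahn–Banach theorem provides a continuous functional `φ ≠ 0` with `φ 1 = 0`, and `x ↦ p (φ x) • 1`
lies in this subspace for every polynomial `p` with `p 0 = 0`.
-/

section StrongDual

variable {R V : Type*} [Field R] [TopologicalSpace R] [IsTopologicalRing R] [AddCommGroup V]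
  [TopologicalSpace V] [Module R V] [SeparatingDual R V]

theorem exists_strongDual_apply_eq_of_linearIndependent {ι : Type*} [Finite ι] {v : ι → V}
    (hv : LinearIndependent R v) (c : ι → R) : ∃ φ : StrongDual R V, ∀ i, φ (v i) = c i := by
  classical
  have := Fintype.ofFinite ι
  obtain ⟨φ, hφ⟩ := SeparatingDual.dualMap_surjective_iff.2
    hv.fintypeLinearCombination_injective (Fintype.linearCombination R c)
  exact ⟨φ, fun i => by simpa using LinearMap.congr_fun hφ (Pi.single i 1)⟩

theorem exists_strongDual_ne_zero_apply_eq_zero (hV : 1 < Module.rank R V) {v : V} (hv : v ≠ 0) :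
    ∃ φ : StrongDual R V, φ ≠ 0 ∧ φ v = 0 := by
  obtain ⟨w, hvw⟩ := exists_linearIndependent_pair_of_one_lt_rank hV hv
  obtain ⟨φ, hφ⟩ := exists_strongDual_apply_eq_of_linearIndependent hvw ![0, 1]
  have hφw : φ w = 1 := hφ 1
  exact ⟨φ, fun h => by simp [h] at hφw, hφ 0⟩

end StrongDual

section LorchDerivative

theorem hasLorchDerivAt_iff_hasFDerivAt (𝕜 : Type*) {E : Type*} [NontriviallyNormedField 𝕜]
    [NormedRing E] [NormedAlgebra 𝕜 E] {f : E → E} {ζ ω : E} :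
    HasLorchDerivAt f ζ ω ↔ HasFDerivAt f (ContinuousLinearMap.mul 𝕜 E ζ) ω := by
  let quotient : E → ℝ := fun h => ‖f (ω + h) - f ω - ζ * h‖ / ‖h‖
  -- Since `0 / 0 = 0`, the quotient has its limit value at `0`, so the limit need not be punctured.
  have quotient_zero : quotient 0 = 0 := by simp [quotient]
  have lorch_iff : HasLorchDerivAt f ζ ω ↔ ContinuousWithinAt quotient {0}ᶜ 0 := by
    rw [ContinuousWithinAt, quotient_zero, HasLorchDerivAt]
  rw [lorch_iff, continuousWithinAt_compl_self, ContinuousAt, quotient_zero,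
    hasFDerivAt_iff_isLittleO_nhds_zero, ← Asymptotics.isLittleO_norm_norm,
    Asymptotics.isLittleO_iff_tendsto fun h hh => by simp [norm_eq_zero.1 hh]]
  rfl

theorem HasLorchDerivAt.hasLineDerivAt_one (𝕜 : Type*) {E : Type*} [NontriviallyNormedField 𝕜]
    [NormedRing E] [NormedAlgebra 𝕜 E] {f : E → E} {ζ ω : E} (h : HasLorchDerivAt f ζ ω) :
    HasLineDerivAt 𝕜 f ζ ω 1 := by
  simpa using ((hasLorchDerivAt_iff_hasFDerivAt 𝕜).1 h).hasLineDerivAt 1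

theorem HasLorchDerivAt.eq_zero_of_forall_add_smul_one {𝕜 E : Type*} [NontriviallyNormedField 𝕜]
    [NormedRing E] [NormedAlgebra 𝕜 E] {f : E → E} {ζ ω : E} (h : HasLorchDerivAt f ζ ω)
    (hf : ∀ t : 𝕜, f (ω + t • (1 : E)) = f ω) : ζ = 0 := by
  have hasLineDerivAt_zero : HasLineDerivAt 𝕜 f 0 ω 1 := by
    simpa only [HasLineDerivAt, hf] using hasDerivAt_const (0 : 𝕜) (f ω)
  exact (h.hasLineDerivAt_one 𝕜).unique hasLineDerivAt_zero

theorem IsLorchAnalytic.eq_of_forall_add_smul_one {𝕜 E : Type*} [RCLike 𝕜] [NormedRing E]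
    [NormedAlgebra 𝕜 E] {f : E → E} (h : IsLorchAnalytic f)
    (hf : ∀ (ω : E) (t : 𝕜), f (ω + t • (1 : E)) = f ω) (x y : E) : f x = f y := by
  have hasFDerivAt_zero : ∀ ω, HasFDerivAt f (0 : E →L[𝕜] E) ω := fun ω => by
    obtain ⟨ζ, hζ⟩ := h ω
    obtain rfl : ζ = 0 := hζ.eq_zero_of_forall_add_smul_one (hf ω)
    simpa using (hasLorchDerivAt_iff_hasFDerivAt 𝕜).1 hζ
  exact is_const_of_fderiv_eq_zero (fun ω => (hasFDerivAt_zero ω).differentiableAt)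
    (fun ω => (hasFDerivAt_zero ω).fderiv) x y

end LorchDerivative

open Polynomial in
theorem not_finite_of_injective_polynomial {R M : Type*} [Ring R] [Nontrivial R]
    [IsNoetherianRing R] [AddCommGroup M] [Module R M] {T : R[X] →ₗ[R] M}
    (hT : Function.Injective T) : ¬ Module.Finite R M :=
  fun _ => Polynomial.not_finite (Module.Finite.of_injective T hT)

namespace Hb

open Polynomial

variable {E : Type*} [NormedRing E] [NormedAlgebra ℂ E]

/-- Evaluation at `x`, as a continuous linear map on `𝓗_b(E, E)`. -/
noncomputable def eval (x : E) : Hb E →L[ℂ] E where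
  toFun f := (f : BddConvFun E).toMap x
  map_add' _ _ := rfl
  map_smul' _ _ := rfl
  cont := (UniformOnFun.uniformContinuous_eval_of_mem E {s : Set E | Bornology.IsBounded s}
    (Set.mem_singleton x) Bornology.isBounded_singleton).continuous.comp continuous_subtype_val

theorem ext_eval {f g : Hb E} (h : ∀ x, eval x f = eval x g) : f = g :=
  Subtype.ext (funext h)

variable (E) in
/-- The maps in `𝓗_b(E, E)` that vanish at `0` and are invariant under translation by the scalar
multiples of `1`, written as an intersection of kernels so that closedness is immediate. -/
noncomputable def scalarInvariant : Submodule ℂ (Hb E) :=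
  (eval (0 : E)).ker ⊓ ⨅ (ω : E) (t : ℂ), (eval (ω + t • (1 : E)) - eval ω).ker

theorem mem_scalarInvariant_iff {f : Hb E} :
    f ∈ scalarInvariant E ↔
      eval 0 f = 0 ∧ ∀ (ω : E) (t : ℂ), eval (ω + t • (1 : E)) f = eval ω f := by
  simp [scalarInvariant, Submodule.mem_iInf, sub_eq_zero]

theorem isClosed_scalarInvariant : IsClosed (scalarInvariant E : Set (Hb E)) := by
  simp only [scalarInvariant, Submodule.coe_inf, Submodule.coe_iInf]
  exact (ContinuousLinearMap.isClosed_ker _).inter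
    (isClosed_iInter fun _ => isClosed_iInter fun _ => ContinuousLinearMap.isClosed_ker _)

theorem eq_zero_of_mem_scalarInvariant {f : Hb E} (hf : f ∈ scalarInvariant E)
    (hL : IsLorchAnalytic (f : BddConvFun E).toMap) : f = 0 := by
  obtain ⟨hf0, hf⟩ := mem_scalarInvariant_iff.1 hf
  exact ext_eval fun x => (hL.eq_of_forall_add_smul_one hf x 0).trans hf0

theorem comp_continuousLinearMap_mem {F : Type*} [NormedAddCommGroup F] [NormedSpace ℂ F]
    [ProperSpace F] {g : F → E} (hg : AnalyticOnNhd ℂ g Set.univ) (φ : E →L[ℂ] F) :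
    UniformOnFun.ofFun {s : Set E | Bornology.IsBounded s} (g ∘ φ) ∈ Hb E := by
  refine ⟨fun x _ => (hg (φ x) trivial).comp (φ.analyticAt x), fun s hs => ?_⟩
  have isCompact_closure : IsCompact (closure (φ '' s)) := (hs.image φ).isCompact_closure
  have hg_cont : Continuous g := continuousOn_univ.1 hg.continuousOn
  refine (isCompact_closure.image hg_cont).isBounded.subset ?_
  exact (Set.image_comp g φ s).trans_subset (Set.image_mono subset_closure)

/-- The map `x ↦ p (φ x) • 1`, as an element of `𝓗_b(E, E)` depending linearly on the
polynomial `p`. -/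
noncomputable def ofPolynomial (φ : StrongDual ℂ E) : ℂ[X] →ₗ[ℂ] Hb E where
  toFun p := ⟨_, comp_continuousLinearMap_mem
    ((AnalyticOnNhd.eval_polynomial p).smul (analyticOnNhd_const (v := (1 : E)))) φ⟩
  map_add' p q := ext_eval fun x => by
    change (p + q).eval (φ x) • (1 : E) = p.eval (φ x) • (1 : E) + q.eval (φ x) • (1 : E)
    rw [eval_add, add_smul]
  map_smul' c p := ext_eval fun x => by
    change (c • p).eval (φ x) • (1 : E) = c • p.eval (φ x) • (1 : E)
    rw [eval_smul, smul_assoc]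

@[simp]
theorem eval_ofPolynomial (φ : StrongDual ℂ E) (p : ℂ[X]) (x : E) :
    eval x (ofPolynomial φ p) = p.eval (φ x) • (1 : E) :=
  rfl

theorem ofPolynomial_injective {φ : StrongDual ℂ E} (hφ : φ ≠ 0) :
    Function.Injective (ofPolynomial φ) := by
  obtain ⟨x, hx⟩ := DFunLike.ne_iff.1 hφ
  have : Nontrivial E := ⟨x, 0, fun h => hx (by simp [h])⟩
  have φ_surjective : Function.Surjective φ := LinearMap.surjective (f := φ.toLinearMap)
    fun h => hφ (ContinuousLinearMap.coe_injective h)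
  refine fun p q hpq => Polynomial.funext fun z => ?_
  obtain ⟨y, rfl⟩ := φ_surjective z
  exact smul_left_injective ℂ one_ne_zero (congrArg (eval y) hpq)

theorem ofPolynomial_mem_scalarInvariant {φ : StrongDual ℂ E} (hφ : φ 1 = 0) {p : ℂ[X]}
    (hp : p.eval 0 = 0) : ofPolynomial φ p ∈ scalarInvariant E := by
  simp [mem_scalarInvariant_iff, hφ, hp]

theorem not_finiteDimensional_scalarInvariant {φ : StrongDual ℂ E} (hφ : φ ≠ 0) (hφ1 : φ 1 = 0) :
    ¬ FiniteDimensional ℂ (scalarInvariant E) := by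
  let T : ℂ[X] →ₗ[ℂ] scalarInvariant E :=
    (ofPolynomial φ ∘ₗ LinearMap.mulLeft ℂ X).codRestrict _ fun p =>
      ofPolynomial_mem_scalarInvariant hφ1 (by simp)
  have T_injective : Function.Injective T := (LinearMap.injective_codRestrict_iff _).2 <|
    (ofPolynomial_injective hφ).comp (mul_right_injective₀ X_ne_zero)
  exact not_finite_of_injective_polynomial (M := scalarInvariant E) T_injective

end Hb

theorem mainTheorem6_general {E : Type*} [NormedRing E] [NormedAlgebra ℂ E]
    (hE : 1 < Module.rank ℂ E) : IsSpaceable (Gb E) := by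
  have : Nontrivial E := rank_pos_iff_nontrivial.1 (zero_lt_one.trans hE)
  obtain ⟨φ, hφ, hφ1⟩ := exists_strongDual_ne_zero_apply_eq_zero hE (one_ne_zero (α := E))
  refine ⟨Hb.scalarInvariant E, Hb.isClosed_scalarInvariant,
    Hb.not_finiteDimensional_scalarInvariant hφ hφ1, fun f hf => ?_⟩
  by_cases hL : IsLorchAnalytic (f : BddConvFun E).toMap
  · exact Or.inr (Hb.eq_zero_of_mem_scalarInvariant hf hL)
  · exact Or.inl hL

theorem mainTheorem6 {E : Type*} [NormedRing E] [NormedAlgebra ℂ E] [CompleteSpace E]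
    (hE : 1 < Module.rank ℂ E) : IsSpaceable (Gb E) :=
  mainTheorem6_general hE
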